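/- Let $A$ be an infinite-dimensional (complex, not necessarily unital) C*-algebra and let $\mathcal U$ be a non-principal ultrafilter on $\mathbb N$. Let $l^\infty(A)$ be the C*-algebra of bounded sequences in $A$ with pointwise operations and the supremum norm, let $c_{\mathcal U}(A)=\{(x_n)\in l^\infty(A):\lim_{n\to\mathcal U}\|x_n\|=0\}$, which is a closed two-sided ideal, and let $A^{\mathcal U}=l^\infty(A)/c_{\mathcal U}(A)$ be the ultrapower, a C*-algebra; write $(x_n)^{\mathcal U}$ for the class of $(x_n)$. A state is a positive linear functional of norm $1$. Then there is a state $\phi$ on $A^{\mathcal U}$ that is not a $\mathcal U$-limit of states on $A$, i.e. there is no sequence $(\psi_n)$ of states on $A$ such that $\phi\big((x_n)^{\mathcal U}\big)=\lim_{n\to\mathcal U}\psi_n(x_n)$ for all $(x_n)\in l^\infty(A)$. -/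

import Mathlib

open Filter Topology
open scoped ENNReal ComplexOrder

noncomputable section

namespace CStarUltrapower

/-- `l^∞(A)`, the C*-algebra of bounded sequences in `A` with pointwise operations and sup norm. -/
abbrev BddSeq (A : Type*) [NonUnitalCStarAlgebra A] : Type _ :=
  lp (fun _ : ℕ => A) ∞

/-- `c_U(A)`, the bounded sequences `x` in `A` with `lim_{n → U} ‖x n‖ = 0`. -/
def nullSeq (U : Ultrafilter ℕ) (A : Type*) [NonUnitalCStarAlgebra A] :
    Submodule ℂ (BddSeq A) where
  carrier := {x | Tendsto (fun n => ‖x n‖) U (𝓝 0)}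
  zero_mem' := by simp
  add_mem' := by
    intro x y hx hy
    refine squeeze_zero (fun n => norm_nonneg _) (fun n => norm_add_le (x n) (y n)) ?_
    simpa using Tendsto.add hx hy
  smul_mem' := by
    intro c x hx
    simpa [norm_smul] using Tendsto.const_mul ‖c‖ hx

/-- The ultrapower `A^U = l^∞(A) / c_U(A)`. -/
def Ultrapower (U : Ultrafilter ℕ) (A : Type*) [NonUnitalCStarAlgebra A] : Type _ :=
  BddSeq A ⧸ nullSeq U A

section Structure

variable {A : Type*} [NonUnitalCStarAlgebra A] {U : Ultrafilter ℕ}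

lemma mem_nullSeq {x : BddSeq A} :
    x ∈ nullSeq U A ↔ Tendsto (fun n => ‖x n‖) U (𝓝 0) := Iff.rfl

lemma norm_coord_le (x : BddSeq A) (n : ℕ) : ‖x n‖ ≤ ‖x‖ :=
  lp.norm_apply_le_norm ENNReal.top_ne_zero x n

lemma isClosed_nullSeq (U : Ultrafilter ℕ) (A : Type*) [NonUnitalCStarAlgebra A] :
    IsClosed (nullSeq U A : Set (BddSeq A)) := by
  refine isClosed_of_closure_subset fun x hx => ?_
  change Tendsto (fun n => ‖x n‖) U (𝓝 0)
  rw [Metric.tendsto_nhds]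
  intro ε hε
  obtain ⟨y, hy, hxy⟩ := Metric.mem_closure_iff.1 hx (ε / 2) (half_pos hε)
  have hy' : ∀ᶠ n in (U : Filter ℕ), ‖y n‖ < ε / 2 :=
    (mem_nullSeq.1 hy).eventually (gt_mem_nhds (half_pos hε))
  filter_upwards [hy'] with n hn
  have h1 : ‖x n - y n‖ ≤ ‖x - y‖ := norm_coord_le (x - y) n
  rw [dist_eq_norm] at hxy
  have h2 : ‖x n‖ ≤ ‖x n - y n‖ + ‖y n‖ := by
    simpa using norm_add_le (x n - y n) (y n)
  rw [Real.dist_eq, sub_zero, abs_of_nonneg (norm_nonneg _)]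
  linarith

instance : IsClosed (nullSeq U A : Set (BddSeq A)) := isClosed_nullSeq U A

lemma mul_sub_mul_mem {x x' y y' : BddSeq A} (hx : x - x' ∈ nullSeq U A)
    (hy : y - y' ∈ nullSeq U A) : x * y - x' * y' ∈ nullSeq U A := by
  have h : Tendsto (fun n => ‖(x - x') n‖ * ‖y‖ + ‖x'‖ * ‖(y - y') n‖) U (𝓝 0) := by
    simpa using (Tendsto.mul_const ‖y‖ hx).add (Tendsto.const_mul ‖x'‖ hy)
  refine squeeze_zero (fun n => norm_nonneg _) (fun n => ?_) h
  have e : (x * y - x' * y') n = (x - x') n * y n + x' n * (y - y') n := by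
    change x n * y n - x' n * y' n = (x n - x' n) * y n + x' n * (y n - y' n)
    noncomm_ring
  rw [e]
  refine (norm_add_le _ _).trans (add_le_add ?_ ?_)
  · exact (norm_mul_le _ _).trans
      (mul_le_mul_of_nonneg_left (norm_coord_le y n) (norm_nonneg _))
  · exact (norm_mul_le _ _).trans
      (mul_le_mul_of_nonneg_right (norm_coord_le x' n) (norm_nonneg _))

lemma star_sub_star_mem {x x' : BddSeq A} (hx : x - x' ∈ nullSeq U A) :
    star x - star x' ∈ nullSeq U A := by
  rw [← star_sub, mem_nullSeq]
  have e : (fun n => ‖(star (x - x')) n‖) = fun n => ‖(x - x') n‖ := by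
    funext n
    exact norm_star ((x - x') n)
  rw [e]
  exact hx

instance : NormedAddCommGroup (Ultrapower U A) :=
  inferInstanceAs (NormedAddCommGroup (BddSeq A ⧸ nullSeq U A))

instance : NormedSpace ℂ (Ultrapower U A) :=
  inferInstanceAs (NormedSpace ℂ (BddSeq A ⧸ nullSeq U A))

instance : CompleteSpace (Ultrapower U A) :=
  inferInstanceAs (CompleteSpace (BddSeq A ⧸ nullSeq U A))

/-- The quotient map `l^∞(A) → A^U`, sending a bounded sequence `x` to its class `(x_n)^U`. -/
def mk (U : Ultrafilter ℕ) (A : Type*) [NonUnitalCStarAlgebra A] :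
    BddSeq A →ₗ[ℂ] Ultrapower U A := (nullSeq U A).mkQ

lemma mk_surjective : Function.Surjective (mk U A : BddSeq A → Ultrapower U A) :=
  (nullSeq U A).mkQ_surjective

lemma mk_eq_mk {x y : BddSeq A} : mk U A x = mk U A y ↔ x - y ∈ nullSeq U A :=
  Submodule.Quotient.eq (nullSeq U A)

instance : Mul (Ultrapower U A) where
  mul := Quotient.map₂ (· * ·) fun _ _ hx _ _ hy =>
    (Submodule.quotientRel_def _).2 (mul_sub_mul_mem
      ((Submodule.quotientRel_def _).1 hx) ((Submodule.quotientRel_def _).1 hy))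

instance : Star (Ultrapower U A) where
  star := Quotient.map star fun _ _ hx =>
    (Submodule.quotientRel_def _).2 (star_sub_star_mem ((Submodule.quotientRel_def _).1 hx))

lemma mk_mul (x y : BddSeq A) : mk U A (x * y) = mk U A x * mk U A y := rfl

lemma mk_star (x : BddSeq A) : mk U A (star x) = star (mk U A x) := rfl

lemma norm_mk_le (x : BddSeq A) : ‖mk U A x‖ ≤ ‖x‖ :=
  Submodule.Quotient.norm_mk_le (nullSeq U A) x

/-- The norm of `(x_n)^U` is the limit of `‖x n‖` along `U`. -/
lemma tendsto_norm (x : BddSeq A) : Tendsto (fun n => ‖x n‖) U (𝓝 ‖mk U A x‖) := by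
  obtain ⟨L, -, hL⟩ := isCompact_Icc.ultrafilter_le_nhds (U.map fun n => ‖x n‖)
    (s := Set.Icc 0 ‖x‖) (by
      rw [le_principal_iff]
      change ∀ᶠ n in (U : Filter ℕ), ‖x n‖ ∈ Set.Icc 0 ‖x‖
      exact Eventually.of_forall fun n => ⟨norm_nonneg _, norm_coord_le x n⟩)
  replace hL : Tendsto (fun n => ‖x n‖) U (𝓝 L) := hL
  suffices h : ‖mk U A x‖ = L by rwa [h]
  apply le_antisymm
  · refine le_of_forall_pos_le_add fun ε hε => ?_
    have hL0 : 0 ≤ L := ge_of_tendsto' hL fun n => norm_nonneg _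
    let f : ℕ → A := fun n => if ‖x n‖ < L + ε then x n else 0
    have hf : ∀ n, ‖f n‖ ≤ L + ε := fun n => by
      by_cases h : ‖x n‖ < L + ε
      · simpa [f, h] using h.le
      · simp only [f, h, if_false, norm_zero]; linarith
    let y : BddSeq A := ⟨f, memℓp_infty ⟨L + ε, by rintro _ ⟨n, rfl⟩; exact hf n⟩⟩
    have hxy : mk U A x = mk U A y := by
      rw [mk_eq_mk, mem_nullSeq]
      refine tendsto_const_nhds.congr' ?_
      filter_upwards [hL.eventually (gt_mem_nhds (lt_add_of_pos_right L hε))] with n hn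
      have e : (x - y) n = x n - f n := rfl
      simp [e, f, hn]
    rw [hxy]
    exact (norm_mk_le y).trans (lp.norm_le_of_forall_le (by linarith) hf)
  · refine le_of_forall_pos_le_add fun ε hε => ?_
    obtain ⟨y, hy, hlt⟩ := Submodule.Quotient.norm_mk_lt (mk U A x : BddSeq A ⧸ nullSeq U A) hε
    have hxy : x - y ∈ nullSeq U A := mk_eq_mk.1 hy.symm
    refine le_trans ?_ hlt.le
    have h : Tendsto (fun n => ‖(x - y) n‖ + ‖y‖) U (𝓝 (0 + ‖y‖)) :=
      Tendsto.add_const _ hxy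
    rw [zero_add] at h
    refine le_of_tendsto_of_tendsto' hL h fun n => ?_
    have h2 : ‖x n‖ ≤ ‖x n - y n‖ + ‖y n‖ := by
      simpa using norm_add_le (x n - y n) (y n)
    exact h2.trans (by gcongr; exacts [le_rfl, norm_coord_le y n])

instance : NonUnitalNormedRing (Ultrapower U A) where
  left_distrib a b c := by
    obtain ⟨x, rfl⟩ := mk_surjective a
    obtain ⟨y, rfl⟩ := mk_surjective b
    obtain ⟨z, rfl⟩ := mk_surjective c
    simp only [← map_add, ← mk_mul, mul_add]
  right_distrib a b c := by
    obtain ⟨x, rfl⟩ := mk_surjective a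
    obtain ⟨y, rfl⟩ := mk_surjective b
    obtain ⟨z, rfl⟩ := mk_surjective c
    simp only [← map_add, ← mk_mul, add_mul]
  zero_mul a := by
    obtain ⟨x, rfl⟩ := mk_surjective a
    rw [← map_zero (mk U A), ← mk_mul, zero_mul]
  mul_zero a := by
    obtain ⟨x, rfl⟩ := mk_surjective a
    rw [← map_zero (mk U A), ← mk_mul, mul_zero]
  mul_assoc a b c := by
    obtain ⟨x, rfl⟩ := mk_surjective a
    obtain ⟨y, rfl⟩ := mk_surjective b
    obtain ⟨z, rfl⟩ := mk_surjective c
    simp only [← mk_mul, mul_assoc]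
  dist_eq := NormedAddCommGroup.dist_eq
  norm_mul_le a b := by
    obtain ⟨x, rfl⟩ := mk_surjective a
    obtain ⟨y, rfl⟩ := mk_surjective b
    rw [← mk_mul]
    exact le_of_tendsto_of_tendsto' (tendsto_norm (x * y))
      ((tendsto_norm x).mul (tendsto_norm y)) fun n => norm_mul_le (x n) (y n)

instance : StarRing (Ultrapower U A) where
  star_involutive a := by
    obtain ⟨x, rfl⟩ := mk_surjective a
    rw [← mk_star, ← mk_star, star_star]
  star_mul a b := by
    obtain ⟨x, rfl⟩ := mk_surjective a
    obtain ⟨y, rfl⟩ := mk_surjective b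
    simp only [← mk_mul, ← mk_star, star_mul]
  star_add a b := by
    obtain ⟨x, rfl⟩ := mk_surjective a
    obtain ⟨y, rfl⟩ := mk_surjective b
    simp only [← map_add, ← mk_star, star_add]

/-- The ultrapower of a C*-algebra is a C*-algebra, with the operations induced by the pointwise
ones on representing sequences, and the quotient norm. -/
instance : NonUnitalCStarAlgebra (Ultrapower U A) where
  norm_mul_self_le a := by
    obtain ⟨x, rfl⟩ := mk_surjective a
    rw [← mk_star, ← mk_mul]
    refine le_of_tendsto_of_tendsto' ((tendsto_norm x).mul (tendsto_norm x))
      (tendsto_norm (star x * x)) fun n => ?_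
    exact (CStarRing.norm_star_mul_self (x := x n)).symm.le
  smul_assoc c a b := by
    obtain ⟨x, rfl⟩ := mk_surjective a
    obtain ⟨y, rfl⟩ := mk_surjective b
    simp only [smul_eq_mul, ← map_smul, ← mk_mul, smul_mul_assoc]
  smul_comm c a b := by
    obtain ⟨x, rfl⟩ := mk_surjective a
    obtain ⟨y, rfl⟩ := mk_surjective b
    simp only [smul_eq_mul, ← map_smul, ← mk_mul, mul_smul_comm]
  star_smul c a := by
    obtain ⟨x, rfl⟩ := mk_surjective a
    simp only [← map_smul, ← mk_star, star_smul]

end Structure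

/-- A state on a (not necessarily unital) C*-algebra: a positive linear functional of norm `1`.
The positive elements of a C*-algebra are exactly those of the form `star b * b`. -/
def IsState {B : Type*} [NonUnitalCStarAlgebra B] (φ : StrongDual ℂ B) : Prop :=
  (∀ b : B, 0 ≤ φ (star b * b)) ∧ ‖φ‖ = 1

/-- `φ` is the `U`-limit of the functionals `ψ n`:
`φ ((x_n)^U) = lim_{n → U} ψ n (x n)` for every bounded sequence `x` in `A`. -/
def IsUltralimit {A : Type*} [NonUnitalCStarAlgebra A] (U : Ultrafilter ℕ)
    (ψ : ℕ → StrongDual ℂ A) (φ : StrongDual ℂ (Ultrapower U A)) : Prop :=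
  ∀ x : BddSeq A, Tendsto (fun n => ψ n (x n)) U (𝓝 (φ (mk U A x)))

end CStarUltrapower

end

/-!
Suppose quasi-states `h k` and elements `P n` of the unit ball of `A` violate the double limit
criterion: `lim_n h k (P n) = 1` for every `k`, while `lim_k h k (P n) = 0` for every `n`. The
iterated limit `φ x = lim_k lim_n h k (x n)` along `U` then vanishes on every constant sequence
`P m` and equals `1` on `(P (N n))` whenever `N → ∞` along `U`; in particular it is a state. If `φ`
were the ultralimit of functionals `ψ n`, then `ψ n (P m) → 0` for each `m`, so `N n` could tend to
infinity slowly enough to keep `ψ n (P (N n))` small, contradicting the value `1`.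

A self-adjoint `a` with infinite spectrum supplies such `h k` and `P n`: evaluations at spectral
points converging to an accumulation point `l`, and functions of `a` that vanish at `l` and increase
to `1` at every other nonzero point. If instead all spectra of self-adjoint elements are finite,
there are no infinite families of orthogonal projections, hence finitely many minimal projections
that no nonzero element annihilates simultaneously; so `A` embeds in a finite product of corners
`e A f` with `e`, `f` minimal, and each of these is at most one-dimensional.
-/

namespace CStarUltrapower

variable {A : Type*} [NonUnitalCStarAlgebra A]

/-- A quasi-state on a C*-algebra: a positive linear functional of norm at most `1`. Unlike the
states, the quasi-states are closed under pointwise limits and under restriction to a subalgebra. -/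
structure IsQuasistate (φ : StrongDual ℂ A) : Prop where
  star_mul_self_nonneg : ∀ b : A, 0 ≤ φ (star b * b)
  norm_le_one : ‖φ‖ ≤ 1

lemma IsQuasistate.isState {φ : StrongDual ℂ A} (hφ : IsQuasistate φ) {x : A} (hx : ‖x‖ ≤ 1)
    (h : φ x = 1) : IsState φ :=
  ⟨hφ.star_mul_self_nonneg, hφ.norm_le_one.antisymm <| by
    simpa [h] using φ.le_opNorm_of_le hx⟩

lemma IsQuasistate.exists_comp {B : Type*} [NonUnitalCStarAlgebra B] {φ : StrongDual ℂ B}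
    (hφ : IsQuasistate φ) (π : A →⋆ₙₐ[ℂ] B) :
    ∃ ψ : StrongDual ℂ A, IsQuasistate ψ ∧ ∀ a, ψ a = φ (π a) := by
  have hbound (a : A) : ‖φ (π a)‖ ≤ 1 * ‖a‖ :=
    φ.le_of_opNorm_le_of_le hφ.norm_le_one (NonUnitalStarAlgHom.norm_apply_le π a)
  refine ⟨(φ.toLinearMap ∘ₗ (π : A →ₗ[ℂ] B)).mkContinuous 1 hbound, ⟨fun b => ?_,
    LinearMap.mkContinuous_norm_le _ zero_le_one _⟩, fun a => rfl⟩
  change 0 ≤ φ (π (star b * b))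
  rw [map_mul, map_star]
  exact hφ.star_mul_self_nonneg (π b)

lemma exists_norm_le_tendsto_of_ultrafilter {ι 𝕜 E : Type*} [NontriviallyNormedField 𝕜]
    [ProperSpace 𝕜] [SeminormedAddCommGroup E] [NormedSpace 𝕜 E] (V : Ultrafilter ι)
    {g : ι → StrongDual 𝕜 E} {C : ℝ} (hg : ∀ i, ‖g i‖ ≤ C) :
    ∃ φ : StrongDual 𝕜 E, ‖φ‖ ≤ C ∧ ∀ x, Tendsto (fun i => g i x) V (𝓝 (φ x)) := by
  obtain ⟨φ, hφ, hlim⟩ :=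
    (WeakDual.isCompact_closedBall (0 : StrongDual 𝕜 E) C).ultrafilter_le_nhds
      (V.map fun i => StrongDual.toWeakDual (g i)) <| by
        rw [le_principal_iff]
        change ∀ᶠ i in (V : Filter ι), _
        exact Eventually.of_forall fun i => by simpa using hg i
  exact ⟨WeakDual.toStrongDual φ, by simpa using hφ,
    fun x => ((WeakDual.eval_continuous x).tendsto φ).comp hlim⟩

lemma exists_isQuasistate_tendsto {ι : Type*} (V : Ultrafilter ι) {ψ : ι → StrongDual ℂ A}
    (hψ : ∀ i, IsQuasistate (ψ i)) :
    ∃ φ : StrongDual ℂ A, IsQuasistate φ ∧ ∀ x, Tendsto (fun i => ψ i x) V (𝓝 (φ x)) := by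
  obtain ⟨φ, hφ, hlim⟩ := exists_norm_le_tendsto_of_ultrafilter V fun i => (hψ i).norm_le_one
  exact ⟨φ, ⟨fun b => ge_of_tendsto' (hlim _) fun i => (hψ i).star_mul_self_nonneg b, hφ⟩, hlim⟩

lemma exists_extension_comp_linearIsometry {𝕜 E F : Type*} [RCLike 𝕜] [NormedAddCommGroup F]
    [NormedSpace 𝕜 F] [SeminormedAddCommGroup E] [NormedSpace 𝕜 E] (L : F →ₗᵢ[𝕜] E)
    (f : StrongDual 𝕜 F) : ∃ g : StrongDual 𝕜 E, ‖g‖ ≤ ‖f‖ ∧ ∀ y, g (L y) = f y := by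
  obtain ⟨g, hext, hnorm⟩ := exists_extension_norm_eq L.toLinearMap.range
    (f.comp (L.equivRange.symm.toContinuousLinearEquiv : L.toLinearMap.range →L[𝕜] F))
  refine ⟨g, hnorm.trans_le (ContinuousLinearMap.opNorm_le_bound _ (norm_nonneg _) fun y => ?_),
    fun y => by simpa using hext (L.equivRange y)⟩
  simpa using f.le_opNorm (L.equivRange.symm y)

lemma map_mem_closedBall_of_spectrum_subset {B : Type*} [CStarAlgebra B] {h : StrongDual ℂ B}
    (hn : ‖h‖ ≤ 1) (h1 : h 1 = 1) {c : B} (hc : IsStarNormal c) {z : ℂ} {r : ℝ} (hr : 0 ≤ r)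
    (hz : spectrum ℂ c ⊆ Metric.closedBall z r) : h c ∈ Metric.closedBall z r := by
  have hcfc : c - algebraMap ℂ B z = cfc (fun w => w - z) c := by
    rw [cfc_sub .., cfc_id' .., cfc_const ..]
  have hnorm : ‖c - algebraMap ℂ B z‖ ≤ r := by
    rw [hcfc]
    exact norm_cfc_le hr fun w hw => mem_closedBall_iff_norm.1 (hz hw)
  have hmap : h (c - algebraMap ℂ B z) = h c - z := by
    simp [Algebra.algebraMap_eq_smul_one, h1]
  rw [mem_closedBall_iff_norm, ← hmap]
  simpa using h.le_of_opNorm_le_of_le hn hnorm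

-- The half-plane `0 ≤ re (conj z * w)` is exhausted by large discs centred at positive multiples
-- of `z`.
lemma re_conj_mul_map_nonneg_of_spectrum {B : Type*} [CStarAlgebra B] {h : StrongDual ℂ B}
    (hn : ‖h‖ ≤ 1) (h1 : h 1 = 1) {c : B} (hc : IsStarNormal c) {z : ℂ}
    (hz : ∀ w ∈ spectrum ℂ c, 0 ≤ (starRingEnd ℂ z * w).re) : 0 ≤ (starRingEnd ℂ z * h c).re := by
  have : Nontrivial B := ⟨1, 0, fun e => by simp [e] at h1⟩
  have hdist (w : ℂ) (t : ℝ) :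
      ‖w - t * z‖ ^ 2 = ‖w‖ ^ 2 - 2 * t * (starRingEnd ℂ z * w).re + ‖t * z‖ ^ 2 := by
    have hcross : w * starRingEnd ℂ (t * z) = t * (starRingEnd ℂ z * w) := by
      rw [map_mul, Complex.conj_ofReal]
      ring
    rw [Complex.sq_norm, Complex.normSq_sub, hcross, Complex.re_ofReal_mul, ← Complex.sq_norm,
      ← Complex.sq_norm]
    ring
  have hdisc (t : ℝ) (ht : 0 ≤ t) : ‖h c - t * z‖ ^ 2 ≤ ‖c‖ ^ 2 + ‖t * z‖ ^ 2 := by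
    refine (Real.le_sqrt (norm_nonneg _) (by positivity)).1 <| mem_closedBall_iff_norm.1 <|
      map_mem_closedBall_of_spectrum_subset hn h1 hc (Real.sqrt_nonneg _) fun w hw => ?_
    rw [mem_closedBall_iff_norm, Real.le_sqrt (norm_nonneg _) (by positivity), hdist]
    nlinarith [mul_nonneg ht (hz w hw), norm_nonneg w, spectrum.norm_le_norm_of_mem hw]
  by_contra! hneg
  obtain ⟨t, ht, hlt⟩ : ∃ t : ℝ, 0 ≤ t ∧ ‖c‖ ^ 2 < -2 * t * (starRingEnd ℂ z * h c).re := by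
    refine ⟨(‖c‖ ^ 2 + 1) / (-2 * (starRingEnd ℂ z * h c).re), ?_, ?_⟩
    · have : 0 < -2 * (starRingEnd ℂ z * h c).re := by linarith
      positivity
    · have := hneg.ne
      field_simp
      linarith
  have := hdisc t ht
  rw [hdist] at this
  nlinarith [sq_nonneg ‖h c‖]

lemma isQuasistate_of_map_one {B : Type*} [CStarAlgebra B] {h : StrongDual ℂ B} (hn : ‖h‖ ≤ 1)
    (h1 : h 1 = 1) : IsQuasistate h := by
  refine ⟨fun b => ?_, hn⟩
  have hspec (w : ℂ) (hw : w ∈ spectrum ℂ (star b * b)) : 0 ≤ w := by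
    let _ := CStarAlgebra.spectralOrder B
    have _ := CStarAlgebra.spectralOrderedRing B
    exact spectrum_nonneg_of_nonneg (star_mul_self_nonneg b) hw
  have hhalf (z : ℂ) (hz : 0 ≤ z.re) : 0 ≤ (starRingEnd ℂ z * h (star b * b)).re := by
    refine re_conj_mul_map_nonneg_of_spectrum hn h1 (IsSelfAdjoint.star_mul_self b).isStarNormal
      fun w hw => ?_
    obtain ⟨hre, him⟩ := Complex.nonneg_iff.1 (hspec w hw)
    simpa [← him] using mul_nonneg hz hre
  have hre := hhalf 1 (by simp)
  have him := hhalf Complex.I (by simp)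
  have him' := hhalf (-Complex.I) (by simp)
  simp only [map_one, one_mul] at hre
  simp only [map_neg, Complex.conj_I, neg_neg, neg_mul, Complex.neg_re, Complex.I_mul_re]
    at him him'
  exact Complex.nonneg_iff.2 ⟨hre, by linarith⟩

lemma exists_isQuasistate_cfc_eq {B : Type*} [CStarAlgebra B] {b : B} (hb : IsStarNormal b) {z : ℂ}
    (hz : z ∈ spectrum ℂ b) : ∃ h : StrongDual ℂ B, IsQuasistate h ∧
      ∀ f : ℂ → ℂ, ContinuousOn f (spectrum ℂ b) → h (cfc f b) = f z := by
  let L : C(spectrum ℂ b, ℂ) →ₗᵢ[ℂ] B :=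
    { toLinearMap := (cfcHom hb : C(spectrum ℂ b, ℂ) →⋆ₐ[ℂ] B).toAlgHom.toLinearMap
      norm_map' := fun g => norm_cfcHom b g hb }
  have hev : ‖(ContinuousMap.evalCLM ℂ ⟨z, hz⟩ : StrongDual ℂ C(spectrum ℂ b, ℂ))‖ ≤ 1 :=
    ContinuousLinearMap.opNorm_le_bound _ zero_le_one fun g => by
      simpa using g.norm_coe_le_norm ⟨z, hz⟩
  obtain ⟨h, hn, hext⟩ := exists_extension_comp_linearIsometry L (ContinuousMap.evalCLM ℂ ⟨z, hz⟩)
  have hcfc (f : ℂ → ℂ) (hf : ContinuousOn f (spectrum ℂ b)) : h (cfc f b) = f z := by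
    rw [cfc_apply f b hb hf]
    exact hext _
  refine ⟨h, isQuasistate_of_map_one (hn.trans hev) ?_, hcfc⟩
  simpa [cfc_const_one ℂ b] using hcfc (fun _ => 1) continuousOn_const

lemma exists_isQuasistate_cfcₙ_eq {a : A} (ha : IsSelfAdjoint a) {t : ℝ}
    (ht : t ∈ quasispectrum ℝ a) : ∃ h : StrongDual ℂ A, IsQuasistate h ∧
      ∀ f : ℝ → ℝ, Continuous f → f 0 = 0 → h (cfcₙ f a) = f t := by
  have hsa : IsSelfAdjoint (a : Unitization ℂ A) := ha.inr ℂ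
  have ht' : (t : ℂ) ∈ spectrum ℂ (a : Unitization ℂ A) := by
    rw [Unitization.quasispectrum_eq_spectrum_inr' _ ℂ] at ht
    simpa using spectrum.algebraMap_mem ℂ ht
  obtain ⟨h, hh, hcfc⟩ := exists_isQuasistate_cfc_eq hsa.isStarNormal ht'
  obtain ⟨ψ, hψ, hψh⟩ := hh.exists_comp (Unitization.inrNonUnitalStarAlgHom ℂ A)
  refine ⟨ψ, hψ, fun f hf hf0 => ?_⟩
  rw [hψh, Unitization.inrNonUnitalStarAlgHom_apply, Unitization.real_cfcₙ_eq_cfc_inr a f hf0,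
    cfc_real_eq_complex f hsa, hcfc _ (by fun_prop), Complex.ofReal_re]

section Ultralimit

variable {U : Ultrafilter ℕ}

lemma exists_isUltralimit_of_tendsto {ψ : ℕ → StrongDual ℂ A} {C : ℝ} (hψ : ∀ n, ‖ψ n‖ ≤ C)
    {Φ : StrongDual ℂ (BddSeq A)} (hΦ : ∀ x, Tendsto (fun n => ψ n (x n)) U (𝓝 (Φ x))) :
    ∃ φ : StrongDual ℂ (Ultrapower U A), ‖φ‖ ≤ C ∧ IsUltralimit U ψ φ := by
  have hC : 0 ≤ C := (norm_nonneg _).trans (hψ 0)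
  have hbound (x : BddSeq A) : ‖Φ x‖ ≤ C * ‖mk U A x‖ :=
    le_of_tendsto_of_tendsto' (hΦ x).norm ((tendsto_norm x).const_mul C)
      fun n => (ψ n).le_of_opNorm_le (hψ n) (x n)
  have hker : nullSeq U A ≤ Φ.toLinearMap.ker := fun x hx => by
    have h0 : mk U A x = 0 := (Submodule.Quotient.mk_eq_zero _).2 hx
    simpa [h0] using hbound x
  refine ⟨((nullSeq U A).liftQ Φ.toLinearMap hker).mkContinuous C fun y => ?_,
    LinearMap.mkContinuous_norm_le _ hC _, hΦ⟩
  obtain ⟨x, rfl⟩ := mk_surjective y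
  exact hbound x

lemma exists_isUltralimit (U : Ultrafilter ℕ) {ψ : ℕ → StrongDual ℂ A} {C : ℝ}
    (hψ : ∀ n, ‖ψ n‖ ≤ C) :
    ∃ φ : StrongDual ℂ (Ultrapower U A), ‖φ‖ ≤ C ∧ IsUltralimit U ψ φ := by
  have hcomp (n : ℕ) : ‖(ψ n).comp (lp.evalCLM ℂ (fun _ : ℕ => A) ∞ n)‖ ≤ C :=
    ContinuousLinearMap.opNorm_le_bound _ ((norm_nonneg _).trans (hψ 0)) fun x =>
      (ψ n).le_of_opNorm_le_of_le (hψ n) (norm_coord_le x n)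
  obtain ⟨Φ, -, hΦ⟩ := exists_norm_le_tendsto_of_ultrafilter U hcomp
  exact exists_isUltralimit_of_tendsto hψ hΦ

lemma exists_isQuasistate_isUltralimit (U : Ultrafilter ℕ) {ψ : ℕ → StrongDual ℂ A}
    (hψ : ∀ n, IsQuasistate (ψ n)) :
    ∃ φ : StrongDual ℂ (Ultrapower U A), IsQuasistate φ ∧ IsUltralimit U ψ φ := by
  obtain ⟨φ, hn, hφ⟩ := exists_isUltralimit U fun n => (hψ n).norm_le_one
  refine ⟨φ, ⟨fun b => ?_, hn⟩, hφ⟩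
  obtain ⟨x, rfl⟩ := mk_surjective b
  exact ge_of_tendsto' (hφ (star x * x)) fun n => (hψ n).star_mul_self_nonneg (x n)

/-- The sequence `n ↦ x (N n)` obtained by reindexing a bounded sequence `x` along `N`. A constant
`N` gives the constant sequences, whose classes form the copy of `A` in the ultrapower. -/
def reindex (N : ℕ → ℕ) (x : BddSeq A) : BddSeq A :=
  ⟨fun n => x (N n), memℓp_infty ⟨‖x‖, by rintro _ ⟨n, rfl⟩; exact norm_coord_le x (N n)⟩⟩

lemma exists_tendsto_atTop_eventually {l : Filter ℕ} (hl : l ≤ atTop) {p : ℕ → ℕ → Prop}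
    (hp : ∀ m, ∀ᶠ n in l, p m n) : ∃ N : ℕ → ℕ, Tendsto N l atTop ∧ ∀ᶠ n in l, p (N n) n := by
  classical
  refine ⟨fun n => Nat.findGreatest (p · n) n, tendsto_atTop.2 fun m => ?_, ?_⟩
  · filter_upwards [hp m, hl (eventually_ge_atTop m)] with n hm hn
    exact Nat.le_findGreatest hn hm
  · filter_upwards [hp 0] with n h0
    exact Nat.findGreatest_spec (P := (p · n)) n.zero_le h0

lemma not_isUltralimit_of_reindex (hU : (U : Filter ℕ) ≤ atTop)
    {φ : StrongDual ℂ (Ultrapower U A)} {P : BddSeq A}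
    (h0 : ∀ m, φ (mk U A (reindex (fun _ => m) P)) = 0)
    (h1 : ∀ N : ℕ → ℕ, Tendsto N U atTop → φ (mk U A (reindex N P)) = 1)
    (ψ : ℕ → StrongDual ℂ A) : ¬ IsUltralimit U ψ φ := fun hψ => by
  have hsmall (m : ℕ) : ∀ᶠ n in (U : Filter ℕ), ‖ψ n (P m)‖ < 1 / 2 := by
    have hlim := (hψ (reindex (fun _ => m) P)).norm
    rw [h0, norm_zero] at hlim
    exact hlim.eventually_lt_const (by norm_num)
  obtain ⟨N, hN, hdiag⟩ := exists_tendsto_atTop_eventually hU hsmall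
  have hlim := (hψ (reindex N P)).norm
  rw [h1 N hN, norm_one] at hlim
  have : (1 : ℝ) ≤ 1 / 2 := le_of_tendsto hlim (hdiag.mono fun n hn => hn.le)
  norm_num at this

lemma exists_isState_not_isUltralimit (hU : (U : Filter ℕ) ≤ atTop) {h : ℕ → StrongDual ℂ A}
    (hh : ∀ k, IsQuasistate (h k)) {P : BddSeq A} (hP : ‖P‖ ≤ 1)
    (h1 : ∀ k, Tendsto (fun n => h k (P n)) atTop (𝓝 1))
    (h0 : ∀ n, Tendsto (fun k => h k (P n)) atTop (𝓝 0)) :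
    ∃ φ : StrongDual ℂ (Ultrapower U A), IsState φ ∧
      ∀ ψ : ℕ → StrongDual ℂ A, ¬ IsUltralimit U ψ φ := by
  choose H hH hlim using fun k => exists_isQuasistate_isUltralimit U fun _ => hh k
  obtain ⟨φ, hφ, hHφ⟩ := exists_isQuasistate_tendsto U hH
  have hconst (m : ℕ) : φ (mk U A (reindex (fun _ => m) P)) = 0 := by
    refine tendsto_nhds_unique (hHφ _) (((h0 m).mono_left hU).congr fun k => ?_)
    exact tendsto_nhds_unique tendsto_const_nhds (hlim k (reindex (fun _ => m) P))
  have hdiv (N : ℕ → ℕ) (hN : Tendsto N U atTop) : φ (mk U A (reindex N P)) = 1 := by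
    refine tendsto_nhds_unique (hHφ _) (tendsto_const_nhds.congr fun k => ?_)
    exact tendsto_nhds_unique ((h1 k).comp hN) (hlim k (reindex N P))
  exact ⟨φ, hφ.isState ((norm_mk_le P).trans hP) (hdiv id hU),
    not_isUltralimit_of_reindex hU hconst hdiv⟩

end Ultralimit

section DoubleLimit

lemma exists_tendsto_forall_mem_ne {X : Type*} [TopologicalSpace X] [FrechetUrysohnSpace X]
    {s K : Set X} (hs : s.Infinite) (hK : IsCompact K) (hsK : s ⊆ K) :
    ∃ (l : X) (u : ℕ → X), (∀ k, u k ∈ s ∧ u k ≠ l) ∧ Tendsto u atTop (𝓝 l) := by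
  obtain ⟨l, -, hl⟩ := hs.exists_accPt_of_subset_isCompact hK hsK
  rw [accPt_principal_iff_clusterPt, ← mem_closure_iff_clusterPt, mem_closure_iff_seq_limit] at hl
  obtain ⟨u, hu, hlim⟩ := hl
  exact ⟨l, u, hu, hlim⟩

/-- Continuous functions with values in `[0, 1]` that vanish at `0` and at `l` and increase with `n`
to `1` everywhere else. Vanishing at `0` makes them admissible in the non-unital functional
calculus. -/
def cutoff (l : ℝ) (n : ℕ) (t : ℝ) : ℝ := min 1 (n * |t * (t - l)|)

lemma continuous_cutoff (l : ℝ) (n : ℕ) : Continuous (cutoff l n) := by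
  unfold cutoff
  fun_prop

lemma cutoff_zero (l : ℝ) (n : ℕ) : cutoff l n 0 = 0 := by simp [cutoff]

lemma cutoff_self (l : ℝ) (n : ℕ) : cutoff l n l = 0 := by simp [cutoff]

lemma norm_cutoff_le_one (l : ℝ) (n : ℕ) (t : ℝ) : ‖cutoff l n t‖ ≤ 1 := by
  rw [cutoff, Real.norm_of_nonneg (le_min zero_le_one (by positivity))]
  exact min_le_left _ _

lemma tendsto_cutoff {l t : ℝ} (h0 : t ≠ 0) (hl : t ≠ l) :
    Tendsto (fun n => cutoff l n t) atTop (𝓝 1) := by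
  have hpos : 0 < |t * (t - l)| := abs_pos.2 (mul_ne_zero h0 (sub_ne_zero.2 hl))
  refine tendsto_const_nhds.congr' ?_
  filter_upwards [(tendsto_natCast_atTop_atTop.atTop_mul_const hpos).eventually_ge_atTop 1]
    with n hn
  exact (min_eq_left hn).symm

lemma exists_isQuasistate_double_limit {a : A} (ha : IsSelfAdjoint a)
    (hinf : (quasispectrum ℝ a).Infinite) :
    ∃ (h : ℕ → StrongDual ℂ A) (P : BddSeq A), (∀ k, IsQuasistate (h k)) ∧ ‖P‖ ≤ 1 ∧
      (∀ k, Tendsto (fun n => h k (P n)) atTop (𝓝 1)) ∧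
      ∀ n, Tendsto (fun k => h k (P n)) atTop (𝓝 0) := by
  obtain ⟨l, u, hu, hlim⟩ := exists_tendsto_forall_mem_ne (hinf.sdiff (Set.finite_singleton 0))
    (quasispectrum.isCompact a) Set.sdiff_subset
  choose h hh heval using fun k => exists_isQuasistate_cfcₙ_eq ha (hu k).1.1
  replace heval (k n : ℕ) : h k (cfcₙ (cutoff l n) a) = cutoff l n (u k) :=
    heval k _ (continuous_cutoff l n) (cutoff_zero l n)
  have hnorm (n : ℕ) : ‖cfcₙ (cutoff l n) a‖ ≤ 1 := norm_cfcₙ_le fun t _ => norm_cutoff_le_one l n t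
  refine ⟨h, ⟨fun n => cfcₙ (cutoff l n) a, memℓp_infty ⟨1, by rintro _ ⟨n, rfl⟩; exact hnorm n⟩⟩,
    hh, lp.norm_le_of_forall_le zero_le_one hnorm, fun k => ?_, fun n => ?_⟩
  · simp only [heval]
    exact_mod_cast (Complex.continuous_ofReal.tendsto 1).comp (tendsto_cutoff (hu k).1.2 (hu k).2)
  · simp only [heval]
    have hcut := ((continuous_cutoff l n).tendsto l).comp hlim
    rw [cutoff_self] at hcut
    exact_mod_cast (Complex.continuous_ofReal.tendsto 0).comp hcut

end DoubleLimit

section FiniteSpectra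

lemma mem_quasispectrum_of_mul_eq_smul {R A : Type*} [CommRing R] [NonUnitalRing A] [Module R A]
    [IsScalarTower R A A] [SMulCommClass R A A] {a e : A} {r : R} (he : e ≠ 0)
    (h : a * e = r • e) : r ∈ quasispectrum R a := by
  rw [Unitization.quasispectrum_eq_spectrum_inr R, spectrum.mem_iff]
  intro hu
  have h0 : (algebraMap R (Unitization R A) r - a) * (e : Unitization R A) = 0 := by
    rw [sub_mul, ← Unitization.inr_mul, h, Algebra.algebraMap_eq_smul_one, smul_mul_assoc, one_mul,
      Unitization.inr_smul, sub_self]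
  exact he (Unitization.inr_injective (R := R) (by simpa using hu.mul_right_eq_zero.1 h0))

lemma mul_eq_zero_symm_of_isSelfAdjoint {R : Type*} [NonUnitalSemiring R] [StarRing R] {x y : R}
    (hx : IsSelfAdjoint x) (hy : IsSelfAdjoint y) (h : x * y = 0) : y * x = 0 := by
  have := congrArg star h
  rwa [star_mul, hx.star_eq, hy.star_eq, star_zero] at this

variable (A) in
/-- All self-adjoint elements have finite spectrum. This characterizes finite-dimensionality. -/
def HasFiniteSpectra : Prop :=
  ∀ a : A, IsSelfAdjoint a → (quasispectrum ℝ a).Finite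

lemma not_hasFiniteSpectra_of_pairwise_orthogonal {e : ℕ → A} (he : ∀ n, IsStarProjection (e n))
    (h0 : ∀ n, e n ≠ 0) (ho : Pairwise fun m n => e m * e n = 0) : ¬ HasFiniteSpectra A := by
  have hs : Summable fun n : ℕ => ((1 / 2 : ℝ) ^ n) • e n := by
    refine Summable.of_norm_bounded summable_geometric_two fun n => ?_
    rw [norm_smul, Real.norm_of_nonneg (by positivity)]
    exact mul_le_of_le_one_right (by positivity) (he n).norm_le
  have hsa : IsSelfAdjoint (∑' n : ℕ, ((1 / 2 : ℝ) ^ n) • e n) := by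
    rw [IsSelfAdjoint, tsum_star]
    exact tsum_congr fun n => by rw [star_smul, (he n).isSelfAdjoint.star_eq, star_trivial]
  refine fun hA => Set.infinite_of_injective_forall_mem (f := fun n : ℕ => (1 / 2 : ℝ) ^ n)
    (pow_right_injective₀ (by norm_num) (by norm_num)) (fun n => ?_) (hA _ hsa)
  refine mem_quasispectrum_of_mul_eq_smul (h0 n) ?_
  rw [← hs.tsum_mul_right,
    tsum_eq_single n fun m hm => by rw [smul_mul_assoc, ho hm, smul_zero], smul_mul_assoc,
    (he n).isIdempotentElem.eq]

/-- The spectral projection of `a` at the point `t`, meant for self-adjoint `a` of finite spectrum.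
At `t = 0` the indicator function is not admissible in the non-unital functional calculus, and the
value is `0`. -/
noncomputable def spectralProjection (a : A) (t : ℝ) : A := cfcₙ (Pi.single t 1 : ℝ → ℝ) a

lemma spectralProjection_zero (a : A) : spectralProjection a 0 = 0 :=
  cfcₙ_apply_of_not_map_zero a (by simp)

section SpectralProjection

variable {a : A} (hf : (quasispectrum ℝ a).Finite)
include hf

lemma isStarProjection_spectralProjection (t : ℝ) :
    IsStarProjection (spectralProjection a t) := by
  rcases eq_or_ne t 0 with rfl | ht
  · rw [spectralProjection_zero]
    exact .zero A
  have h0 : (Pi.single t 1 : ℝ → ℝ) 0 = 0 := Pi.single_eq_of_ne ht.symm 1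
  refine ⟨?_, cfcₙ_predicate _ a⟩
  rw [IsIdempotentElem, spectralProjection, ← cfcₙ_mul _ _ a (hf.continuousOn _) h0
    (hf.continuousOn _) h0]
  refine cfcₙ_congr fun x _ => ?_
  rcases eq_or_ne x t with rfl | hx <;> simp [*]

lemma smul_spectralProjection (ha : IsSelfAdjoint a) (t : ℝ) :
    t • spectralProjection a t = spectralProjection a t * a := by
  rcases eq_or_ne t 0 with rfl | ht
  · rw [spectralProjection_zero, smul_zero, zero_mul]
  have h0 : (Pi.single t 1 : ℝ → ℝ) 0 = 0 := Pi.single_eq_of_ne ht.symm 1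
  calc t • spectralProjection a t
    _ = cfcₙ (fun x => t • (Pi.single t 1 : ℝ → ℝ) x) a :=
      (cfcₙ_smul t _ a (hf.continuousOn _) h0).symm
    _ = cfcₙ (fun x => (Pi.single t 1 : ℝ → ℝ) x * x) a := cfcₙ_congr fun x _ => ?_
    _ = spectralProjection a t * cfcₙ (fun x : ℝ => x) a :=
      cfcₙ_mul _ _ a (hf.continuousOn _) h0
    _ = spectralProjection a t * a := by rw [cfcₙ_id' ℝ a]
  rcases eq_or_ne x t with rfl | hx <;> simp [*]

lemma sum_smul_spectralProjection (ha : IsSelfAdjoint a) :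
    ∑ t ∈ hf.toFinset, t • spectralProjection a t = a := by
  have hsmul (t : ℝ) : t • spectralProjection a t = cfcₙ (t • (Pi.single t 1 : ℝ → ℝ)) a := by
    rcases eq_or_ne t 0 with rfl | ht
    · simp [cfcₙ_zero]
    · exact (cfcₙ_smul t _ a (hf.continuousOn _) (Pi.single_eq_of_ne ht.symm 1)).symm
  have h0 (t : ℝ) : (t • (Pi.single t 1 : ℝ → ℝ)) 0 = 0 := by
    rcases eq_or_ne t 0 with rfl | ht <;> simp [*]
  simp only [hsmul]
  rw [← cfcₙ_sum _ a _ (fun _ _ => hf.continuousOn _) fun t _ => h0 t]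
  conv_rhs => rw [← cfcₙ_id' ℝ a]
  refine cfcₙ_congr fun x hx => ?_
  simp [Finset.sum_apply, Pi.single_apply, hx]

lemma spectralProjection_mul_eq_zero (ha : IsSelfAdjoint a) {x : A} (hx : a * x = 0) (t : ℝ) :
    spectralProjection a t * x = 0 := by
  rcases eq_or_ne t 0 with rfl | ht
  · rw [spectralProjection_zero, zero_mul]
  refine (smul_eq_zero.1 ?_).resolve_left ht
  rw [← smul_mul_assoc, smul_spectralProjection hf ha, mul_assoc, hx, mul_zero]

lemma spectralProjection_mul_eq_self (ha : IsSelfAdjoint a) {x : A} (hx : a * x = a) (t : ℝ) :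
    spectralProjection a t * x = spectralProjection a t := by
  rcases eq_or_ne t 0 with rfl | ht
  · rw [spectralProjection_zero, zero_mul]
  refine smul_right_injective A ht ?_
  change t • (_ * x) = t • _
  rw [← smul_mul_assoc, smul_spectralProjection hf ha, mul_assoc, hx]

lemma exists_spectralProjection_ne_zero (ha : IsSelfAdjoint a) (h0 : a ≠ 0) :
    ∃ t, spectralProjection a t ≠ 0 := by
  by_contra! h
  refine h0 ?_
  rw [← sum_smul_spectralProjection hf ha]
  simp only [h, smul_zero, Finset.sum_const_zero]

end SpectralProjection

variable (A) in
/-- The projections of a C*-algebra, ordered as elements of the algebra. The atoms of this order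
are the minimal projections. -/
abbrev Projection : Type _ := {p : A // IsStarProjection p}

section Atoms

variable [PartialOrder A] [StarOrderedRing A]

instance : OrderBot (Projection A) where
  bot := ⟨0, .zero A⟩
  bot_le p := p.2.nonneg

lemma pairwise_sub_mul_sub_eq_zero {f : ℕ → Projection A} (hf : Antitone f) :
    Pairwise fun m n => ((f m : A) - f (m + 1)) * ((f n : A) - f (n + 1)) = 0 := by
  have hmul {m n : ℕ} (h : m ≤ n) : (f m : A) * f n = f n :=
    ((f n).2.le_iff_mul_eq_right (f m).2).1 (hf h)
  have hsa (n : ℕ) : IsSelfAdjoint ((f n : A) - f (n + 1)) :=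
    (f n).2.isSelfAdjoint.sub (f (n + 1)).2.isSelfAdjoint
  have hlt {m n : ℕ} (h : m < n) : ((f m : A) - f (m + 1)) * ((f n : A) - f (n + 1)) = 0 := by
    rw [sub_mul, mul_sub, mul_sub, hmul h.le, hmul (h.le.trans n.le_succ), hmul h,
      hmul (Nat.succ_le_of_lt h |>.trans n.le_succ), sub_self]
  intro m n hne
  rcases hne.lt_or_gt with h | h
  · exact hlt h
  · exact mul_eq_zero_symm_of_isSelfAdjoint (hsa n) (hsa m) (hlt h)

lemma HasFiniteSpectra.isAtomic_projection (hA : HasFiniteSpectra A) :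
    IsAtomic (Projection A) := by
  refine isAtomic_of_orderBot_wellFounded_lt (wellFounded_iff_isEmpty_descending_chain.2 ⟨?_⟩)
  rintro ⟨f, hf⟩
  have hanti : StrictAnti f := strictAnti_nat_of_succ_lt hf
  refine not_hasFiniteSpectra_of_pairwise_orthogonal (fun n => ?_) (fun n => ?_)
    (pairwise_sub_mul_sub_eq_zero hanti.antitone) hA
  · exact (f (n + 1)).2.sub_of_mul_eq_left (f n).2
      (((f (n + 1)).2.le_iff_mul_eq_left (f n).2).1 (hf n).le)
  · exact sub_ne_zero.2 fun h => (hf n).ne' (Subtype.ext h)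

lemma HasFiniteSpectra.exists_isAtom_mul_eq_zero (hA : HasFiniteSpectra A) {y : A} (hy : y ≠ 0) :
    ∃ f : Projection A, IsAtom f ∧ ∀ x, y * x = 0 → f * x = 0 := by
  have hsa : IsSelfAdjoint (star y * y) := .star_mul_self y
  have hfin := hA _ hsa
  obtain ⟨t, ht⟩ := exists_spectralProjection_ne_zero hfin hsa
    (CStarRing.star_mul_self_ne_zero_iff y |>.2 hy)
  let q : Projection A := ⟨_, isStarProjection_spectralProjection hfin t⟩
  have := hA.isAtomic_projection
  obtain ⟨f, hf, hfq⟩ := (eq_bot_or_exists_atom_le q).resolve_left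
    fun h => ht (congrArg Subtype.val h)
  refine ⟨f, hf, fun x hx => ?_⟩
  have hqx : (q : A) * x = 0 :=
    spectralProjection_mul_eq_zero hfin hsa (by rw [mul_assoc, hx, mul_zero]) t
  rw [← (f.2.le_iff_mul_eq_left q.2).1 hfq, mul_assoc, hqx, mul_zero]

lemma HasFiniteSpectra.exists_finset_isAtom (hA : HasFiniteSpectra A) :
    ∃ S : Finset (Projection A), (∀ e ∈ S, IsAtom e) ∧ ∀ y : A, (∀ e ∈ S, y * e = 0) → y = 0 := by
  by_contra! h
  have hsymm : Std.Symm fun e f : Projection A => (e : A) * f = 0 :=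
    ⟨fun e f => mul_eq_zero_symm_of_isSelfAdjoint e.2.isSelfAdjoint f.2.isSelfAdjoint⟩
  obtain ⟨e, he, ho⟩ := exists_seq_of_forall_finset_exists' IsAtom
    (fun e f : Projection A => (e : A) * f = 0) fun S hS => by
      obtain ⟨y, hy, hy0⟩ := h S hS
      obtain ⟨f, hf, hfy⟩ := hA.exists_isAtom_mul_eq_zero hy0
      exact ⟨f, hf, fun e he => hsymm.symm f e (hfy e (hy e he))⟩
  exact not_hasFiniteSpectra_of_pairwise_orthogonal (fun n => (e n).2)
    (fun n h0 => (he n).1 (Subtype.ext h0)) ho hA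

lemma HasFiniteSpectra.conjugate_mem_span_of_isSelfAdjoint (hA : HasFiniteSpectra A)
    {e : Projection A} (he : IsAtom e) {x : A} (hx : IsSelfAdjoint x) :
    (e : A) * x * e ∈ Submodule.span ℂ {(e : A)} := by
  have hsa : IsSelfAdjoint ((e : A) * x * e) := by
    simpa only [e.2.isSelfAdjoint.star_eq] using hx.conjugate (e : A)
  have hfin := hA _ hsa
  rw [← sum_smul_spectralProjection hfin hsa]
  refine Submodule.sum_mem _ fun t _ => Submodule.smul_of_tower_mem _ t ?_
  let q : Projection A := ⟨_, isStarProjection_spectralProjection hfin t⟩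
  have hqe : q ≤ e := (q.2.le_iff_mul_eq_left e.2).2 <|
    spectralProjection_mul_eq_self hfin hsa (by rw [mul_assoc, e.2.isIdempotentElem.eq]) t
  change (q : A) ∈ _
  rcases he.le_iff.1 hqe with h | h
  · rw [h]
    exact Submodule.zero_mem _
  · rw [h]
    exact Submodule.mem_span_singleton_self _

lemma HasFiniteSpectra.conjugate_mem_span (hA : HasFiniteSpectra A) {e : Projection A}
    (he : IsAtom e) (x : A) : (e : A) * x * e ∈ Submodule.span ℂ {(e : A)} := by
  rw [← realPart_add_I_smul_imaginaryPart x, mul_add, add_mul, mul_smul_comm, smul_mul_assoc]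
  exact Submodule.add_mem _ (hA.conjugate_mem_span_of_isSelfAdjoint he (realPart x).2)
    (Submodule.smul_mem _ _ (hA.conjugate_mem_span_of_isSelfAdjoint he (imaginaryPart x).2))

lemma HasFiniteSpectra.exists_mul_mul_mem_span (hA : HasFiniteSpectra A) {e f : Projection A}
    (he : IsAtom e) (hf : IsAtom f) : ∃ u : A, ∀ x : A, (e : A) * x * f ∈ Submodule.span ℂ {u} := by
  by_cases! h : ∀ x : A, (e : A) * x * f = 0
  · exact ⟨0, fun x => by simp [h x]⟩
  obtain ⟨y, hy⟩ := h
  set u : A := e * y * f with hu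
  refine ⟨u, fun x => Submodule.mem_span_singleton.2 ?_⟩
  have hstar : star u = f * star y * e := by
    simp only [hu, star_mul, e.2.isSelfAdjoint.star_eq, f.2.isSelfAdjoint.star_eq, mul_assoc]
  obtain ⟨c, hc⟩ := Submodule.mem_span_singleton.1 (hA.conjugate_mem_span he (y * f * star y))
  obtain ⟨d, hd⟩ := Submodule.mem_span_singleton.1 (hA.conjugate_mem_span hf (star y * e * x))
  have hc' : u * star u = c • (e : A) := by
    rw [hc, hstar, hu]
    simp only [← mul_assoc, f.2.isIdempotentElem.mul_mul_self]
  have hd' : star u * (e * x * f) = d • (f : A) := by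
    rw [hd, hstar]
    simp only [← mul_assoc, e.2.isIdempotentElem.mul_mul_self]
  have hc0 : c ≠ 0 := by
    rintro rfl
    rw [zero_smul, CStarRing.mul_star_self_eq_zero_iff] at hc'
    exact hy hc'
  have huf : u * f = u := by rw [hu, mul_assoc, f.2.isIdempotentElem.eq]
  have hcd : c • ((e : A) * x * f) = d • u := calc
    c • ((e : A) * x * f) = c • (e : A) * (e * x * f) := by
      simp only [smul_mul_assoc, ← mul_assoc, e.2.isIdempotentElem.eq]
    _ = d • u := by rw [← hc', mul_assoc, hd', mul_smul_comm, huf]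
  exact ⟨c⁻¹ * d, by rw [mul_smul, ← hcd, inv_smul_smul₀ hc0]⟩

end Atoms

theorem HasFiniteSpectra.finiteDimensional (hA : HasFiniteSpectra A) : FiniteDimensional ℂ A := by
  let _ := CStarAlgebra.spectralOrder A
  have _ := CStarAlgebra.spectralOrderedRing A
  obtain ⟨S, hS, hzero⟩ := hA.exists_finset_isAtom
  choose u hu using fun e f : S => hA.exists_mul_mul_mem_span (hS e e.2) (hS f f.2)
  let Φ : A →ₗ[ℂ] ∀ i : S × S, Submodule.span ℂ {u i.1 i.2} := LinearMap.pi fun i =>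
    (LinearMap.mulLeftRight ℂ ((i.1 : A), (i.2 : A))).codRestrict _ (hu i.1 i.2)
  refine Module.Finite.of_injective Φ ((injective_iff_map_eq_zero Φ).2 fun x hx => ?_)
  have hcorner (e f : S) : (e : A) * x * f = 0 := congrArg Subtype.val (congrFun hx (e, f))
  have hleft (e : S) : (e : A) * x = 0 := hzero _ fun f hf => hcorner e ⟨f, hf⟩
  refine star_eq_zero.1 (hzero _ fun e he => ?_)
  have := congrArg star (hleft ⟨e, he⟩)
  rwa [star_mul, e.2.isSelfAdjoint.star_eq, star_zero] at this

end FiniteSpectra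

end CStarUltrapower

open CStarUltrapower in
theorem mainTheorem7_general {A : Type*} [NonUnitalCStarAlgebra A] (hA : ¬ FiniteDimensional ℂ A)
    (U : Ultrafilter ℕ) (hU : ∀ n : ℕ, U ≠ pure n) :
    ∃ φ : StrongDual ℂ (Ultrapower U A), IsState φ ∧
      ∀ ψ : ℕ → StrongDual ℂ A, ¬ IsUltralimit U ψ φ := by
  have hU' : (U : Filter ℕ) ≤ atTop := by
    rw [← Nat.cofinite_eq_atTop]
    exact U.le_cofinite_or_eq_pure.resolve_right fun ⟨n, hn⟩ => hU n hn
  obtain ⟨a, ha, hinf⟩ : ∃ a : A, IsSelfAdjoint a ∧ (quasispectrum ℝ a).Infinite := by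
    by_contra! h
    exact hA (HasFiniteSpectra.finiteDimensional h)
  obtain ⟨h, P, hh, hP, h1, h0⟩ := exists_isQuasistate_double_limit ha hinf
  exact exists_isState_not_isUltralimit hU' hh hP h1 h0

open CStarUltrapower in
theorem mainTheorem7 {A : Type*} [NonUnitalCStarAlgebra A] (hA : ¬ FiniteDimensional ℂ A)
    (U : Ultrafilter ℕ) (hU : ∀ n : ℕ, U ≠ pure n) :
    ∃ φ : StrongDual ℂ (Ultrapower U A), IsState φ ∧
      ¬ ∃ ψ : ℕ → StrongDual ℂ A, (∀ n, IsState (ψ n)) ∧ IsUltralimit U ψ φ := by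
  obtain ⟨φ, hφ, hnot⟩ := mainTheorem7_general hA U hU
  exact ⟨φ, hφ, fun ⟨ψ, _, hψ⟩ => hnot ψ hψ⟩
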